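/- Consider the periodic-review lost sales inventory system with lead time $\tau\in\mathbb{N}_0$, holding cost $h>0$ per unit and period, and penalty $p>0$ per unit of lost sales. Demands $D_0,D_1,\dots$ are i.i.d. with mean $\mu>0$. In period $t$ an order $q_{t+\tau}\ge 0$ is placed, which arrives at the start of period $t+\tau$. With $(x)^+=\max(0,x)$, the dynamics are $$I_t=J_{t-1}+q_t,\qquad J_t=(I_t-D_t)^+,\qquad L_t=(D_t-I_t)^+,$$ started empty: $J_{-1}=0$ and $q_t=0$ for $t<\tau$. Let $\mathbf{x}_t$ be the state in period $t$ when the order $q_{t+\tau}$ is decided: $\mathbf{x}_t=(I_t,q_{t+1},\dots,q_{t+\tau-1})$ if $\tau\ge1$, and $\mathbf{x}_t=J_{t-1}$ if $\tau=0$. The cost of period $t$ is $c_t=hJ_t+pL_t$, and the cost rate of a policy $\mathrm{A}$ is $$C(\mathrm{A})=\limsup_{T\to\infty}\mathbb{E}\Big[\frac{1}{T-\tau+1}\sum_{t=\tau}^{T}c_t(\mathrm{A})\Big].$$ The constant order policy $\mathrm{C}^r$ always orders $r$. The projected inventory level (PIL) policy $\mathrm{P}^U$ orders $\mathrm{P}^U_t(\mathbf{x}_t)=(U-\mathbb{E}[J_{t+\tau-1}\mid\mathbf{x}_t])^+$.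 Let $r^*\in\operatorname{argmin}_{0\le r<\mu}C(\mathrm{C}^r)$ and $U(r)=p(\mu-r)/h$. **Theorem.** Suppose that the one-period demand is exponentially distributed with mean $\mu$. Then for every lead time $\tau\in\mathbb{N}_0$, $$C(\mathrm{P}^{U(r^*)})\le C(\mathrm{C}^{r^*})<\infty,$$ and $C(\mathrm{P}^{U^*})\le C(\mathrm{P}^{U(r^*)})$ for every $U^*\in\operatorname{argmin}_{U\ge0}C(\mathrm{P}^{U})$. Moreover, with $a_1=\dfrac{h}{2(\mu-r^*)}$, $$C(\mathrm{C}^{r^*})-C(\mathrm{P}^{U(r^*)})=a_1\liminf_{T\to\infty}\frac{1}{T-\tau+1}\sum_{t=0}^{T-\tau}\mathbb{E}\Big[\big(r^*-\mathrm{P}^{U(r^*)}_t(\mathbf{x}_t)\big)^2\Big],$$ where $\mathbf{x}_t$ is the state in period $t$ under the policy $\mathrm{P}^{U(r^*)}$. -/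

import Mathlib

open MeasureTheory ProbabilityTheory Filter
open scoped ENNReal

namespace LostSales

/-- The state of the lost sales system with lead time `τ` in period `t`, seen when the order of
period `t` is decided: the pair `(J_{t-1}, (q_t, …, q_{t+τ-1}))` of the inventory left at the end
of the previous period and the orders that are outstanding, the one arriving at the start of
period `t` included (there is none if `τ = 0`). For `1 ≤ τ` the inventory level of period `t` is
`I_t = J_{t-1} + q_t`. -/
abbrev State (τ : ℕ) : Type := ℝ × (Fin τ → ℝ)

/-- A policy gives the size `q_{t+τ}` of the order placed in period `t`, which arrives at the start
of period `t + τ`, as a function of `t` and of the state. -/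
abbrev Policy (τ : ℕ) : Type := ℕ → State τ → ℝ

/-- The orders `(q_t, …, q_{t+τ})` that are outstanding once the order `a = q_{t+τ}` is placed. -/
def pipeline {τ : ℕ} (x : State τ) (a : ℝ) : Fin (τ + 1) → ℝ :=
  Fin.snoc (α := fun _ => ℝ) x.2 a

/-- The inventory level `I_t = J_{t-1} + q_t` in state `x` when the order `a` is placed
(the order `a` itself arrives at once if and only if `τ = 0`). -/
def invLevel {τ : ℕ} (x : State τ) (a : ℝ) : ℝ := x.1 + pipeline x a 0

/-- The state of the next period after order `a` and demand `d`: the inventory is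
`J_t = (I_t - d)^+`, and the outstanding orders are `q_{t+1}, …, q_{t+τ}`. -/
def nextState {τ : ℕ} (x : State τ) (a d : ℝ) : State τ :=
  (max 0 (invLevel x a - d), Fin.tail (pipeline x a))

/-- The state `x_t` under policy `A` on the demand sequence `d`, started from the empty system:
no inventory, and `q_t = 0` for `t < τ`. -/
def state {τ : ℕ} (A : Policy τ) (d : ℕ → ℝ) : ℕ → State τ
  | 0 => (0, fun _ => 0)
  | t + 1 => nextState (state A d t) (A t (state A d t)) (d t)

/-- The order `q_{t+τ} = A_t(x_t)` placed in period `t`. -/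
def order {τ : ℕ} (A : Policy τ) (d : ℕ → ℝ) (t : ℕ) : ℝ := A t (state A d t)

/-- The inventory level `I_t` at the beginning of period `t`. -/
def inventory {τ : ℕ} (A : Policy τ) (d : ℕ → ℝ) (t : ℕ) : ℝ :=
  invLevel (state A d t) (order A d t)

/-- The inventory `J_t = (I_t - D_t)^+` at the end of period `t`. -/
def endInventory {τ : ℕ} (A : Policy τ) (d : ℕ → ℝ) (t : ℕ) : ℝ :=
  max 0 (inventory A d t - d t)

/-- The lost sales `L_t = (D_t - I_t)^+` of period `t`. -/
def lostSales {τ : ℕ} (A : Policy τ) (d : ℕ → ℝ) (t : ℕ) : ℝ :=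
  max 0 (d t - inventory A d t)

/-- The cost `c_t = h J_t + p L_t` of period `t`. -/
def cost {τ : ℕ} (h p : ℝ) (A : Policy τ) (d : ℕ → ℝ) (t : ℕ) : ℝ :=
  h * endInventory A d t + p * lostSales A d t

/-- The cost rate `C(A) = limsup_T E[c[τ,T](A) / (T - τ + 1)]`, as an extended nonnegative
number (costs are nonnegative), when the demand in period `t` is the random variable `D t`. -/
noncomputable def costRate {Ω : Type*} [MeasurableSpace Ω] (P : Measure Ω) (D : ℕ → Ω → ℝ)
    (h p : ℝ) {τ : ℕ} (A : Policy τ) : ℝ≥0∞ :=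
  limsup (fun T : ℕ => ∫⁻ ω, ENNReal.ofReal
    ((∑ t ∈ Finset.Icc τ T, cost h p A (fun s => D s ω) t) / ((T : ℝ) - τ + 1)) ∂P) atTop

/-- The constant order policy `C^r`. -/
def constantOrder {τ : ℕ} (r : ℝ) : Policy τ := fun _ _ => r

/-- The inventory `J_{t+n-1}` at the end of period `t + n - 1` when `J_{t-1} = y`, the orders
arriving in periods `t, …, t+n-1` are `q 0, …, q (n-1)` and the demands of these periods are
`d 0, …, d (n-1)`. -/
def finalInventory : (n : ℕ) → ℝ → (Fin n → ℝ) → (Fin n → ℝ) → ℝ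
  | 0, y, _, _ => y
  | n + 1, y, q, d => finalInventory n (max 0 (y + q 0 - d 0)) (Fin.tail q) (Fin.tail d)

/-- The conditional expectation `E[J_{t+τ-1} | x_t = x]` for i.i.d. demands with law `ν`: the
demands of the periods `t, …, t+τ-1` are independent of `x_t` and have joint law `ν ⊗ ⋯ ⊗ ν`. -/
noncomputable def projectedInventory (ν : Measure ℝ) {τ : ℕ} (x : State τ) : ℝ :=
  ∫ d, finalInventory τ x.1 x.2 d ∂(Measure.pi fun _ : Fin τ => ν)

/-- The projected inventory level policy `P^U`: order `(U - E[J_{t+τ-1} | x_t])^+`. -/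
noncomputable def projectedInventoryLevel (ν : Measure ℝ) {τ : ℕ} (U : ℝ) : Policy τ :=
  fun _ x => max 0 (U - projectedInventory ν x)

/-- The limit inferior over `T` of `(T - τ + 1)⁻¹ ∑_{t=0}^{T-τ} E[(A_t(x_t) - B_t(x_t))²]`, where
`x_t` is the state under policy `A`. -/
noncomputable def orderDivergence {Ω : Type*} [MeasurableSpace Ω] (P : Measure Ω)
    (D : ℕ → Ω → ℝ) {τ : ℕ} (A B : Policy τ) : ℝ≥0∞ :=
  liminf (fun T : ℕ => (∑ t ∈ Finset.range (T + 1 - τ), ∫⁻ ω, ENNReal.ofReal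
    ((B t (state A (fun s => D s ω) t) - order A (fun s => D s ω) t) ^ 2) ∂P)
      / ENNReal.ofReal ((T : ℝ) - τ + 1)) atTop

end LostSales

namespace LostSales

/-! For exponential demand the relative value function of `C^r` is quadratic: V(x) = a x² + (2ar -
p) x with a = h / (2(μ - r)), where x is the leftover inventory. Integration by parts gives E[J_t²]
+ 2μ E[J_t] = E[I_t²] (`integral_leftover_pow`). Hence, for every policy with bounded orders, the
expected period cost plus the drift of V equals g + a E[(q - r)²] + 2a E[(q - r)(J + r - U(r))],
where q is the arriving order, J the inventory it meets, and g = a r² + p(μ - r)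
(`integral_cost_add`).

The order is a function of the state at which it is placed, so J may be replaced by its projection
(`integral_order_mul_leftover`). Started empty, the projected inventory never exceeds U
(`projectedInventory_state_le`), so the PIL order is exactly U minus the projection. For U = U(r)
the cross term is then -2a E[(q - r)²], and the whole expression is g - a E[(q - r)²]. Under `C^r`
both terms vanish and g is the cost rate.

Averaging over time telescopes V. The boundary term is negligible if E[J²] grows sublinearly: under
PIL the inventory is bounded, under `C^r` a drift bound on the third moment suffices
(`tendsto_leftover_sq_div`). So average cost plus a times average squared deviation tends to g, and
`limsup_add_liminf_eq` splits this limit into the two rates (`costRate_add_orderDivergence`). -/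

/-- The order `q_s` arriving at the start of period `s`. -/
def arrival {τ : ℕ} (A : Policy τ) (d : ℕ → ℝ) (s : ℕ) : ℝ :=
  if s < τ then 0 else order A d (s - τ)

/-! ### Sample paths: recursions and bounds for a fixed demand sequence. -/

section Paths

variable {τ : ℕ} {A : Policy τ} {d : ℕ → ℝ}

lemma arrival_add (t : ℕ) : arrival A d (t + τ) = order A d t := by
  simp [arrival]

lemma pipeline_of_state {t : ℕ} (h : ∀ i : Fin τ, (state A d t).2 i = arrival A d (t + i))
    (i : Fin (τ + 1)) : pipeline (state A d t) (order A d t) i = arrival A d (t + i) := by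
  refine Fin.lastCases ?_ (fun j => ?_) i
  · simp [pipeline, arrival_add]
  · simp [pipeline, h]

lemma state_snd (t : ℕ) (i : Fin τ) : (state A d t).2 i = arrival A d (t + i) := by
  induction t generalizing i with
  | zero => simp [state, arrival]
  | succ t ih =>
    have := pipeline_of_state ih i.succ
    rw [show t + 1 + (i : ℕ) = t + i.succ by simp; ring, ← this]
    rfl

lemma pipeline_state (t : ℕ) (i : Fin (τ + 1)) :
    pipeline (state A d t) (order A d t) i = arrival A d (t + i) :=
  pipeline_of_state (state_snd t) i

lemma inventory_eq (t : ℕ) : inventory A d t = (state A d t).1 + arrival A d t := by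
  simp [inventory, invLevel, pipeline_state]

lemma endInventory_eq (t : ℕ) : endInventory A d t = (state A d (t + 1)).1 := rfl

lemma state_succ_fst (t : ℕ) :
    (state A d (t + 1)).1 = max 0 ((state A d t).1 + arrival A d t - d t) := by
  rw [← inventory_eq]
  rfl

lemma state_fst_nonneg (t : ℕ) : 0 ≤ (state A d t).1 := by
  cases t with
  | zero => simp [state]
  | succ t => rw [state_succ_fst]; exact le_max_left _ _

/-- Since L_t = D_t - I_t + J_t, the cost is linear in demand, arrival and two consecutive
leftovers. -/
lemma cost_eq (h p : ℝ) (t : ℕ) : cost h p A d t = h * (state A d (t + 1)).1 +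
    p * (d t - arrival A d t + (state A d (t + 1)).1 - (state A d t).1) := by
  rw [cost, endInventory_eq, lostSales, inventory_eq, state_succ_fst]
  congr 2
  rcases le_total ((state A d t).1 + arrival A d t) (d t) with H | H
  · rw [max_eq_right (by linarith), max_eq_left (by linarith)]; ring
  · rw [max_eq_left (by linarith), max_eq_right (by linarith)]; ring

lemma cost_nonneg {h p : ℝ} (hh : 0 ≤ h) (hp : 0 ≤ p) (t : ℕ) : 0 ≤ cost h p A d t :=
  add_nonneg (mul_nonneg hh (le_max_left _ _)) (mul_nonneg hp (le_max_left _ _))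

lemma state_congr {d' : ℕ → ℝ} (t : ℕ) (h : ∀ s < t, d s = d' s) :
    state A d t = state A d' t := by
  induction t with
  | zero => rfl
  | succ t ih =>
    have := ih fun s hs => h s (by omega)
    simp only [state, this, h t (by omega)]

lemma arrival_nonneg (h : ∀ t, 0 ≤ order A d t) (s : ℕ) : 0 ≤ arrival A d s := by
  unfold arrival
  split_ifs
  exacts [le_rfl, h _]

lemma arrival_le {B : ℝ} (hB : 0 ≤ B) (h : ∀ t, order A d t ≤ B) (s : ℕ) :
    arrival A d s ≤ B := by
  unfold arrival
  split_ifs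
  exacts [hB, h _]

lemma state_fst_of_lt (hd : ∀ t, 0 ≤ d t) {t : ℕ} (ht : t ≤ τ) : (state A d t).1 = 0 := by
  induction t with
  | zero => rfl
  | succ t ih =>
    rw [state_succ_fst, ih (by omega), arrival, if_pos (by omega)]
    simpa using hd t

lemma state_fst_le {B : ℝ} (hB : 0 ≤ B) (h : ∀ t, order A d t ≤ B) (hd : ∀ t, 0 ≤ d t) (t : ℕ) :
    (state A d t).1 ≤ t * B := by
  induction t with
  | zero => simp [state]
  | succ t ih =>
    rw [state_succ_fst]
    push_cast
    have := arrival_le hB h t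
    have := hd t
    have : 0 ≤ (t : ℝ) * B := by positivity
    exact max_le (by nlinarith) (by nlinarith)

end Paths

/-! ### Inventory after n periods as a function of initial stock, orders and demands. -/

section FinalInventory

lemma finalInventory_mono {n : ℕ} {y y' : ℝ} (h : y ≤ y') (q d : Fin n → ℝ) :
    finalInventory n y q d ≤ finalInventory n y' q d := by
  induction n generalizing y y' with
  | zero => exact h
  | succ n ih =>
    exact ih (max_le_max le_rfl (by linarith)) _ _

lemma finalInventory_nonneg {n : ℕ} {y : ℝ} (h : 0 ≤ y) (q d : Fin n → ℝ) :
    0 ≤ finalInventory n y q d := by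
  induction n generalizing y with
  | zero => exact h
  | succ n ih => exact ih (le_max_left _ _) _ _

/-- Both sides face the same demands. On the left each order comes one period earlier relative to
them, which can only turn lost sales into sales; on the right the last order comes after all demand
and is kept in full. -/
lemma finalInventory_shift {n : ℕ} (y : ℝ) (q : Fin (n + 1) → ℝ) (hq : ∀ i, 0 ≤ q i)
    (d : Fin n → ℝ) :
    finalInventory n (y + q 0) (Fin.tail q) d
      ≤ finalInventory n y (Fin.init q) d + q (Fin.last n) := by
  induction n generalizing y with
  | zero => exact le_rfl
  | succ n ih =>
    have key := ih (max 0 (y + q 0 - d 0)) (Fin.tail q) (fun i => hq _) (Fin.tail d)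
    refine le_trans (finalInventory_mono (n := n) ?_ (Fin.tail (Fin.tail q)) (Fin.tail d)) key
    have h1 := hq 1
    have : Fin.tail q 0 = q 1 := rfl
    rw [this]
    refine max_le (add_nonneg (le_max_left _ _) h1) ?_
    have := le_max_right 0 (y + q 0 - d 0)
    linarith

lemma le_finalInventory {n : ℕ} (y : ℝ) (q : Fin n → ℝ) (hq : ∀ i, 0 ≤ q i) (d : Fin n → ℝ) :
    y - ∑ i, d i ≤ finalInventory n y q d := by
  induction n generalizing y with
  | zero => simp [finalInventory]
  | succ n ih =>
    refine le_trans ?_ (ih (max 0 (y + q 0 - d 0)) (Fin.tail q) (fun i => hq _) (Fin.tail d))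
    rw [Fin.sum_univ_succ]
    have := le_max_right 0 (y + q 0 - d 0)
    have := hq 0
    simp only [Fin.tail]
    linarith

lemma finalInventory_le {n : ℕ} {y : ℝ} (hy : 0 ≤ y) {q : Fin n → ℝ} (hq : ∀ i, 0 ≤ q i)
    {d : Fin n → ℝ} (hd : ∀ i, 0 ≤ d i) :
    finalInventory n y q d ≤ y + ∑ i, q i := by
  induction n generalizing y with
  | zero => simp [finalInventory]
  | succ n ih =>
    refine (ih (le_max_left 0 (y + q 0 - d 0)) (q := Fin.tail q) (d := Fin.tail d)
      (fun i => hq _) (fun i => hd _)).trans ?_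
    rw [Fin.sum_univ_succ]
    have : max 0 (y + q 0 - d 0) ≤ y + q 0 :=
      max_le (add_nonneg hy (hq 0)) (by linarith [hd 0])
    simp only [Fin.tail]
    linarith

lemma continuous_finalInventory (n : ℕ) :
    Continuous fun z : (ℝ × (Fin n → ℝ)) × (Fin n → ℝ) =>
      finalInventory n z.1.1 z.1.2 z.2 := by
  induction n with
  | zero => exact continuous_fst.comp continuous_fst
  | succ n ih =>
    have hc : Continuous fun z : (ℝ × (Fin (n + 1) → ℝ)) × (Fin (n + 1) → ℝ) =>
        ((max 0 (z.1.1 + z.1.2 0 - z.2 0), Fin.tail z.1.2), Fin.tail z.2) := by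
      refine .prodMk (.prodMk ?_ (continuous_pi fun i => ?_)) (continuous_pi fun i => ?_)
      · fun_prop
      · exact (continuous_apply i.succ).comp (continuous_snd.comp continuous_fst)
      · exact (continuous_apply i.succ).comp continuous_snd
    exact ih.comp hc

lemma finalInventory_state {τ : ℕ} (A : Policy τ) (d : ℕ → ℝ) (n t : ℕ) :
    finalInventory n (state A d t).1 (fun i => arrival A d (t + i)) (fun i => d (t + i))
      = (state A d (t + n)).1 := by
  induction n generalizing t with
  | zero => rfl
  | succ n ih =>
    rw [show t + (n + 1) = t + 1 + n by ring, ← ih (t + 1), state_succ_fst, finalInventory]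
    congr 1 <;> funext i <;> simp only [Fin.tail, Fin.val_succ] <;> congr 1 <;> ring

lemma finalInventory_state' {τ : ℕ} (A : Policy τ) (d : ℕ → ℝ) (t : ℕ) :
    finalInventory τ (state A d t).1 (state A d t).2 (fun i => d (t + i))
      = (state A d (t + τ)).1 := by
  rw [← finalInventory_state]
  congr 1
  funext i
  exact state_snd t i

end FinalInventory

/-! ### The exponential law: mean and truncated moments. -/

section Exponential

lemma integral_expMeasure {b : ℝ} (hb : 0 < b) (f : ℝ → ℝ) :
    ∫ x, f x ∂(expMeasure b) = ∫ x in Set.Ioi 0, b * Real.exp (-(b * x)) * f x := by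
  have h1 : expMeasure b = volume.withDensity (exponentialPDF b) := rfl
  rw [h1, integral_withDensity_eq_integral_toReal_smul
    (f := exponentialPDF b) (measurable_exponentialPDFReal b).ennreal_ofReal
    (Eventually.of_forall fun x => by simp [exponentialPDF]),
    ← integral_Ici_eq_integral_Ioi, ← integral_indicator measurableSet_Ici]
  congr 1
  funext x
  by_cases hx : 0 ≤ x
  · rw [Set.indicator_of_mem (by simpa using hx), exponentialPDF_of_nonneg hx,
      ENNReal.toReal_ofReal (by positivity), smul_eq_mul]
  · rw [Set.indicator_of_notMem (by simpa using hx), exponentialPDF_of_neg (not_le.1 hx)]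
    simp

lemma ae_nonneg_expMeasure (b : ℝ) : ∀ᵐ x ∂(expMeasure b), 0 ≤ x := by
  have h1 : expMeasure b = volume.withDensity (exponentialPDF b) := rfl
  have : {x : ℝ | ¬ 0 ≤ x} = Set.Iio 0 := by ext; simp
  rw [ae_iff, this, h1, withDensity_apply _ measurableSet_Iio]
  exact lintegral_exponentialPDF_of_nonpos le_rfl

lemma integral_id_expMeasure {b : ℝ} (hb : 0 < b) : ∫ x, x ∂(expMeasure b) = 1 / b := by
  rw [integral_expMeasure hb]
  have := Real.integral_rpow_mul_exp_neg_mul_Ioi (a := 2) (by norm_num) hb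
  rw [Real.Gamma_two, mul_one] at this
  have h2 : (∫ x in Set.Ioi 0, b * Real.exp (-(b * x)) * x)
      = ∫ x in Set.Ioi (0 : ℝ), b * (x ^ ((2 : ℝ) - 1) * Real.exp (-(b * x))) := by
    congr 1
    funext x
    rw [show (2 : ℝ) - 1 = 1 by norm_num, Real.rpow_one]
    ring
  rw [h2, integral_const_mul, this]
  norm_cast
  field_simp

lemma integrable_id_expMeasure {b : ℝ} (hb : 0 < b) : Integrable (fun x => x) (expMeasure b) := by
  -- A non-integrable function would have Bochner integral 0, but the integral is 1 / b > 0.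
  by_contra h
  have := integral_id_expMeasure hb
  rw [integral_undef h] at this
  have : 0 < 1 / b := by positivity
  linarith

/-- With `J = (x - D)^+` and `D` exponential with mean `μ`,
`E[J^(k+1)] + (k+1) μ E[J^k] = x^(k+1)` for `k ≥ 1`. -/
lemma integral_pow_leftover {μ : ℝ} (hμ : 0 < μ) {x : ℝ} (hx : 0 ≤ x) {k : ℕ} (hk : k ≠ 0) :
    ∫ d, (max 0 (x - d) ^ (k + 1) + (k + 1) * μ * max 0 (x - d) ^ k) ∂(expMeasure (1 / μ))
      = x ^ (k + 1) := by
  rw [integral_expMeasure (by positivity)]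
  set e : ℝ → ℝ := fun d => Real.exp (-(1 / μ * d)) with he
  have hsupp : (∫ d in Set.Ioi 0, 1 / μ * e d *
        (max 0 (x - d) ^ (k + 1) + (k + 1) * μ * max 0 (x - d) ^ k))
      = ∫ d in Set.Ioc 0 x, 1 / μ * e d * ((x - d) ^ (k + 1) + (k + 1) * μ * (x - d) ^ k) := by
    rw [← integral_indicator measurableSet_Ioi, ← integral_indicator measurableSet_Ioc]
    congr 1
    funext d
    by_cases h0 : 0 < d
    · by_cases h1 : d ≤ x
      · rw [Set.indicator_of_mem (by simpa using h0),
          Set.indicator_of_mem (by exact ⟨h0, h1⟩), max_eq_right (by linarith)]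
      · rw [Set.indicator_of_mem (by simpa using h0),
          Set.indicator_of_notMem (by simp [h1]), max_eq_left (by linarith)]
        -- Beyond x both powers of the leftover vanish; k ≠ 0 excludes 0 ^ 0 = 1.
        simp [hk]
    · rw [Set.indicator_of_notMem (by simpa using h0),
          Set.indicator_of_notMem (by simp [h0])]
  rw [hsupp, ← intervalIntegral.integral_of_le hx]
  -- The combination of the two powers is chosen so that the integrand has this closed
  -- antiderivative.
  have hderiv : ∀ d ∈ Set.uIcc 0 x, HasDerivAt (fun d => -((x - d) ^ (k + 1) * e d))
      (1 / μ * e d * ((x - d) ^ (k + 1) + (k + 1) * μ * (x - d) ^ k)) d := by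
    intro d _
    have h1 : HasDerivAt (fun d => x - d) (-1) d := by
      simpa using (hasDerivAt_id d).const_sub x
    have h2 : HasDerivAt e (-(1 / μ * e d)) d := by
      have := (((hasDerivAt_id d).const_mul (1 / μ)).neg).exp
      convert! this using 1
      simp [he]
      ring
    convert! ((h1.fun_pow (k + 1)).mul h2).neg using 1
    push_cast
    field_simp
    ring
  rw [intervalIntegral.integral_eq_sub_of_hasDerivAt hderiv]
  · simp [he]
  · apply Continuous.intervalIntegrable
    simp only [he]
    fun_prop

end Exponential

/-- A limit of a sum is the upper limit of one term plus the lower limit of the other. -/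
lemma limsup_add_liminf_eq {u v : ℕ → ℝ≥0∞} {g : ℝ≥0∞}
    (h : Tendsto (fun n => u n + v n) atTop (nhds g)) :
    limsup u atTop + liminf v atTop = g := by
  -- The embedding into `EReal` is monotone and continuous, so it commutes with upper and lower
  -- limits; there limsup u + liminf v lies between liminf (u + v) and limsup (u + v).
  have hm : Monotone ((↑) : ℝ≥0∞ → EReal) :=
    fun _ _ h => EReal.coe_ennreal_le_coe_ennreal_iff.2 h
  have hu := hm.map_limsup_of_continuousAt (F := atTop) u
    continuous_coe_ennreal_ereal.continuousAt
  have hv := hm.map_liminf_of_continuousAt (F := atTop) v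
    continuous_coe_ennreal_ereal.continuousAt
  have hg : Tendsto (((↑) ∘ u : ℕ → EReal) + ((↑) ∘ v : ℕ → EReal)) atTop
      (nhds ((g : ℝ≥0∞) : EReal)) := by
    refine ((continuous_coe_ennreal_ereal.tendsto g).comp h).congr fun n => ?_
    simp
  have h1 := EReal.le_limsup_add (u := ((↑) ∘ u : ℕ → EReal)) (v := ((↑) ∘ v : ℕ → EReal))
    (f := atTop)
  have h2 := EReal.liminf_add_le (u := ((↑) ∘ u : ℕ → EReal)) (v := ((↑) ∘ v : ℕ → EReal))
    (f := atTop) (Or.inl (by rw [← hu]; simp)) (Or.inr (by rw [← hv]; simp))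
  rw [hg.limsup_eq] at h1
  rw [hg.liminf_eq] at h2
  rw [← hu, ← hv, ← EReal.coe_ennreal_add] at h1 h2
  exact le_antisymm (EReal.coe_ennreal_le_coe_ennreal_iff.1 h1)
    (EReal.coe_ennreal_le_coe_ennreal_iff.1 h2)

/-! ### Measurability of states, orders and arrivals in the demand path. -/

section Measurability

variable {τ : ℕ}

lemma measurable_pipeline : Measurable fun z : State τ × ℝ => pipeline z.1 z.2 := by
  refine measurable_pi_lambda _ fun i => ?_
  refine Fin.lastCases ?_ (fun j => ?_) i
  · simpa [pipeline] using measurable_snd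
  · simp only [pipeline, Fin.snoc_castSucc]
    exact (measurable_pi_apply j).comp (measurable_snd.comp measurable_fst)

lemma measurable_invLevel : Measurable fun z : State τ × ℝ => invLevel z.1 z.2 :=
  (measurable_fst.comp measurable_fst).add
    ((measurable_pi_apply (0 : Fin (τ + 1))).comp measurable_pipeline)

lemma measurable_state {A : Policy τ} (hA : ∀ t, Measurable (A t)) (t : ℕ) :
    Measurable fun d => state A d t := by
  induction t with
  | zero => exact measurable_const
  | succ t ih =>
    have h1 : Measurable fun d => (state A d t, A t (state A d t)) :=
      ih.prodMk ((hA t).comp ih)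
    refine Measurable.prodMk ?_ (measurable_pi_lambda _ fun i => ?_)
    · exact measurable_const.max ((measurable_invLevel.comp h1).sub (measurable_pi_apply t))
    · exact (measurable_pi_apply i.succ).comp (measurable_pipeline.comp h1)

lemma measurable_order {A : Policy τ} (hA : ∀ t, Measurable (A t)) (t : ℕ) :
    Measurable fun d => order A d t :=
  (hA t).comp (measurable_state hA t)

lemma measurable_arrival {A : Policy τ} (hA : ∀ t, Measurable (A t)) (t : ℕ) :
    Measurable fun d => arrival A d t := by
  unfold arrival
  split_ifs
  exacts [measurable_const, measurable_order hA _]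

end Measurability

/-! ### The projected inventory and its bounds. -/

section Projection

variable {τ : ℕ} {ν : Measure ℝ}

lemma ae_pi_nonneg [IsProbabilityMeasure ν] (hν : ∀ᵐ x ∂ν, 0 ≤ x) :
    ∀ᵐ d ∂(Measure.pi fun _ : Fin τ => ν), ∀ i, 0 ≤ d i :=
  eventually_all.2 fun i => (Measure.tendsto_eval_ae_ae (i := i)).eventually hν

lemma integrable_finalInventory [IsProbabilityMeasure ν] (hν : ∀ᵐ x ∂ν, 0 ≤ x) {y : ℝ} (hy : 0 ≤ y)
    {q : Fin τ → ℝ} (hq : ∀ i, 0 ≤ q i) :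
    Integrable (fun d => finalInventory τ y q d) (Measure.pi fun _ : Fin τ => ν) := by
  refine Integrable.of_bound (C := y + ∑ i, q i) ?_ ?_
  · exact ((continuous_finalInventory τ).comp
      (continuous_const (y := (y, q)).prodMk continuous_id)).aestronglyMeasurable
  · filter_upwards [ae_pi_nonneg hν] with d hd
    rw [Real.norm_of_nonneg (finalInventory_nonneg hy _ _)]
    exact finalInventory_le hy hq hd

lemma measurable_projectedInventory [IsProbabilityMeasure ν] :
    Measurable fun x : State τ => projectedInventory ν x :=
  (StronglyMeasurable.integral_prod_right
    (continuous_finalInventory τ).stronglyMeasurable).measurable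

lemma projectedInventory_nonneg {x : State τ} (hx : 0 ≤ x.1) : 0 ≤ projectedInventory ν x :=
  integral_nonneg fun _ => finalInventory_nonneg hx _ _

/-- Coupling: the demand d is dropped, and the old and new projections are integrated over the same
τ demands, where `finalInventory_shift` compares them pointwise. -/
lemma projectedInventory_nextState_le [IsProbabilityMeasure ν] (hν : ∀ᵐ x ∂ν, 0 ≤ x) {x : State τ} (hx : 0 ≤ x.1)
    (hq : ∀ i, 0 ≤ x.2 i) {a d : ℝ} (ha : 0 ≤ a) (hd : 0 ≤ d) :
    projectedInventory ν (nextState x a d) ≤ projectedInventory ν x + a := by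
  have hpipe : ∀ i, 0 ≤ pipeline x a i := fun i => by
    refine Fin.lastCases ?_ (fun j => ?_) i
    · simpa [pipeline] using ha
    · simpa [pipeline] using hq j
  have h1 := integrable_finalInventory hν hx hq
  have h2 : projectedInventory ν x + a
      = ∫ e, (finalInventory τ x.1 x.2 e + a) ∂(Measure.pi fun _ : Fin τ => ν) := by
    rw [integral_add h1 (integrable_const _)]
    simp [projectedInventory]
  rw [h2]
  refine integral_mono
    (integrable_finalInventory hν (le_max_left _ _) fun i => hpipe _)
    (h1.add (integrable_const _)) fun e => ?_
  have h3 := finalInventory_shift x.1 (pipeline x a) hpipe e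
  have h4 : Fin.init (pipeline x a) = x.2 := by simp [pipeline]
  have h5 : pipeline x a (Fin.last τ) = a := by simp [pipeline]
  rw [h4, h5] at h3
  refine le_trans (finalInventory_mono ?_ _ _) h3
  exact max_le (add_nonneg hx (hpipe 0)) (by simpa [invLevel] using hd)

/-- Turns an upper bound on the projection into one on the actual inventory: at most τ expected
demands separate them. -/
lemma le_projectedInventory [IsProbabilityMeasure ν] (hν : ∀ᵐ x ∂ν, 0 ≤ x) (hint : Integrable (fun x => x) ν)
    {x : State τ} (hx : 0 ≤ x.1) (hq : ∀ i, 0 ≤ x.2 i) :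
    x.1 - τ * ∫ y, y ∂ν ≤ projectedInventory ν x := by
  have hi : ∀ i ∈ Finset.univ, Integrable (fun d : Fin τ → ℝ => d i)
      (Measure.pi fun _ : Fin τ => ν) := fun i _ =>
    (measurePreserving_eval (fun _ : Fin τ => ν) i).integrable_comp_of_integrable hint
  have hs : ∀ i, ∫ d : Fin τ → ℝ, d i ∂(Measure.pi fun _ : Fin τ => ν) = ∫ y, y ∂ν := fun i => by
    have := (measurePreserving_eval (fun _ : Fin τ => ν) i).hasLaw.integral_eq
    simpa using this
  have h2 : x.1 - τ * ∫ y, y ∂ν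
      = ∫ d : Fin τ → ℝ, (x.1 - ∑ i, d i) ∂(Measure.pi fun _ : Fin τ => ν) := by
    rw [integral_sub (integrable_const _) (integrable_finsetSum _ hi), integral_finsetSum _ hi]
    simp [hs]
  rw [h2]
  exact integral_mono ((integrable_const _).sub (integrable_finsetSum _ hi))
    (integrable_finalInventory hν hx hq) fun d => le_finalInventory _ _ hq _

/-- Under the projected inventory level policy started from the empty system, the projected
inventory never exceeds the target level. -/
lemma projectedInventory_state_le [IsProbabilityMeasure ν] (hν : ∀ᵐ x ∂ν, 0 ≤ x) {U : ℝ} (hU : 0 ≤ U) {d : ℕ → ℝ}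
    (hd : ∀ t, 0 ≤ d t) (t : ℕ) :
    projectedInventory ν (state (τ := τ) (projectedInventoryLevel ν U) d t) ≤ U := by
  have hord : ∀ t, 0 ≤ order (projectedInventoryLevel (τ := τ) ν U) d t :=
    fun _ => le_max_left _ _
  induction t with
  | zero =>
    have : projectedInventory ν (state (τ := τ) (projectedInventoryLevel ν U) d 0)
        ≤ ∫ _, 0 ∂(Measure.pi fun _ : Fin τ => ν) := by
      refine integral_mono_ae (integrable_finalInventory hν le_rfl fun _ => le_rfl)
        (integrable_const _) ?_
      filter_upwards [ae_pi_nonneg hν] with e he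
      simpa [state] using finalInventory_le (le_refl (0 : ℝ)) (q := fun _ => 0)
        (fun _ => le_rfl) he
    exact this.trans (by simpa using hU)
  | succ t ih =>
    refine (projectedInventory_nextState_le hν (state_fst_nonneg t)
      (fun i => by rw [state_snd]; exact arrival_nonneg hord _) (hord t) (hd t)).trans ?_
    rw [order, projectedInventoryLevel, max_eq_right (by linarith)]
    linarith

end Projection

/-! ### Independence of the state from present and future demands. -/

section Independence

variable {Ω : Type*} [MeasurableSpace Ω] {P : Measure Ω}

lemma integral_comp_prodMk_of_indepFun [IsProbabilityMeasure P] {α β : Type*} [MeasurableSpace α] [MeasurableSpace β]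
    {X : Ω → α} {Y : Ω → β} (h : IndepFun X Y P) (hX : AEMeasurable X P)
    (hY : AEMeasurable Y P) {G : α × β → ℝ} (hG : Measurable G)
    (hint : Integrable (fun ω => G (X ω, Y ω)) P) :
    ∫ ω, G (X ω, Y ω) ∂P = ∫ ω, ∫ y, G (X ω, y) ∂(P.map Y) ∂P := by
  have hmap := h.map_prod_eq_prod_map_map hX hY
  have hXY : AEMeasurable (fun ω => (X ω, Y ω)) P := hX.prodMk hY
  have : IsProbabilityMeasure (P.map Y) := Measure.isProbabilityMeasure_map hY
  have : IsProbabilityMeasure (P.map X) := Measure.isProbabilityMeasure_map hX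
  have hint' : Integrable G ((P.map X).prod (P.map Y)) := by
    rw [← hmap]
    exact (integrable_map_measure hG.aestronglyMeasurable hXY).2 hint
  rw [← integral_map hXY hG.aestronglyMeasurable, hmap, integral_prod _ hint']
  exact integral_map hX (hG.stronglyMeasurable.integral_prod_right').aestronglyMeasurable

variable {D : ℕ → Ω → ℝ} {τ : ℕ} {A : Policy τ}

lemma indepFun_state (hindep : iIndepFun D P) (hD : ∀ t, AEMeasurable (D t) P)
    (hA : ∀ t, Measurable (A t)) (t n : ℕ) :
    IndepFun (fun ω => state A (fun s => D s ω) t) (fun ω (i : Fin n) => D (t + i) ω) P := by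
  have h := hindep.indepFun_finset₀ (Finset.range t) (Finset.Ico t (t + n))
    (by rw [Finset.range_eq_Ico]; exact Finset.Ico_disjoint_Ico_consecutive 0 t (t + n)) hD
  -- The state in period t depends only on demands before t (`state_congr`), so the filler 0 from t
  -- on is harmless.
  set φ : (Finset.range t → ℝ) → State τ :=
    fun e => state A (fun s => if hs : s ∈ Finset.range t then e ⟨s, hs⟩ else 0) t with hφ
  set ψ : (Finset.Ico t (t + n) → ℝ) → Fin n → ℝ :=
    fun e i => e ⟨t + i, by simp⟩ with hψ
  have hφm : Measurable φ := by
    refine (measurable_state hA t).comp (measurable_pi_lambda _ fun s => ?_)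
    split_ifs
    exacts [measurable_pi_apply _, measurable_const]
  have hψm : Measurable ψ := measurable_pi_lambda _ fun i => measurable_pi_apply _
  convert! h.comp hφm hψm using 1
  funext ω
  refine state_congr t fun s hs => ?_
  simp [hs]

lemma aemeasurable_path (hD : ∀ t, AEMeasurable (D t) P) :
    AEMeasurable (fun ω s => D s ω) P :=
  aemeasurable_pi_lambda _ hD

lemma map_demands {ν : Measure ℝ} (hindep : iIndepFun D P) (hlaw : ∀ t, HasLaw (D t) ν P)
    (t n : ℕ) :
    P.map (fun ω (i : Fin n) => D (t + i) ω) = Measure.pi fun _ : Fin n => ν := by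
  have hinj : Function.Injective fun i : Fin n => t + (i : ℕ) := fun i j h => by
    ext; simpa using h
  rw [(hindep.precomp hinj).map_fun_eq_pi_map fun i => (hlaw _).aemeasurable]
  congr 1
  funext i
  exact (hlaw _).map_eq

end Independence

lemma _root_.MeasureTheory.Integrable.fun_sub {α : Type*} [MeasurableSpace α] {m : Measure α}
    {f g : α → ℝ} (hf : Integrable f m) (hg : Integrable g m) :
    Integrable (fun x => f x - g x) m :=
  hf.sub hg

/-! ### Moment identities for bounded policies. -/

/-- The standing assumptions on a system with i.i.d. exponential demands that is run by a
measurable policy with orders in `[0, B]`. -/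
structure IsBoundedSystem {Ω : Type*} [MeasurableSpace Ω] (P : Measure Ω) (D : ℕ → Ω → ℝ)
    (μ B : ℝ) {τ : ℕ} (A : Policy τ) : Prop where
  mean_pos : 0 < μ
  indep : iIndepFun D P
  law : ∀ t, HasLaw (D t) (expMeasure (1 / μ)) P
  measurable_policy : ∀ t, Measurable (A t)
  order_nonneg : ∀ d t, 0 ≤ order A d t
  order_le : ∀ d t, order A d t ≤ B

/-- The inventory `J_{t-1}` left over from the previous period as a random variable. -/
def leftover {Ω : Type*} {τ : ℕ} (A : Policy τ) (D : ℕ → Ω → ℝ) (t : ℕ) (ω : Ω) : ℝ :=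
  (state A (fun s => D s ω) t).1

/-- The order `q_t` arriving in period `t` as a random variable. -/
def arriving {Ω : Type*} {τ : ℕ} (A : Policy τ) (D : ℕ → Ω → ℝ) (t : ℕ) (ω : Ω) : ℝ :=
  arrival A (fun s => D s ω) t

namespace IsBoundedSystem

variable {Ω : Type*} [MeasurableSpace Ω] {P : Measure Ω} [IsProbabilityMeasure P]
  {D : ℕ → Ω → ℝ} {μ B : ℝ} {τ : ℕ} {A : Policy τ}

omit [IsProbabilityMeasure P] in
lemma bound_nonneg (S : IsBoundedSystem P D μ B A) : 0 ≤ B :=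
  (S.order_nonneg (fun _ => 0) 0).trans (S.order_le (fun _ => 0) 0)

omit [IsProbabilityMeasure P] in
lemma aemeasurable_demand (S : IsBoundedSystem P D μ B A) (t : ℕ) : AEMeasurable (D t) P :=
  (S.law t).aemeasurable

omit [IsProbabilityMeasure P] in
lemma ae_demand_nonneg (S : IsBoundedSystem P D μ B A) : ∀ᵐ ω ∂P, ∀ t, 0 ≤ D t ω := by
  refine ae_all_iff.2 fun t => ?_
  have := ae_nonneg_expMeasure (1 / μ)
  rw [← (S.law t).map_eq] at this
  exact ae_of_ae_map (S.aemeasurable_demand t) this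

omit [IsProbabilityMeasure P] in
lemma integrable_demand (S : IsBoundedSystem P D μ B A) (t : ℕ) : Integrable (D t) P := by
  have := integrable_id_expMeasure (b := 1 / μ) (by have := S.mean_pos; positivity)
  rw [← (S.law t).map_eq] at this
  exact this.comp_aemeasurable (S.aemeasurable_demand t)

omit [IsProbabilityMeasure P] in
lemma integral_demand (S : IsBoundedSystem P D μ B A) (t : ℕ) : ∫ ω, D t ω ∂P = μ := by
  rw [(S.law t).integral_eq, integral_id_expMeasure (by have := S.mean_pos; positivity)]
  simp

omit [IsProbabilityMeasure P] in
lemma aemeasurable_state (S : IsBoundedSystem P D μ B A) (t : ℕ) :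
    AEMeasurable (fun ω => state A (fun s => D s ω) t) P :=
  (measurable_state S.measurable_policy t).comp_aemeasurable
    (aemeasurable_path S.aemeasurable_demand)

omit [IsProbabilityMeasure P] in
lemma aemeasurable_leftover (S : IsBoundedSystem P D μ B A) (t : ℕ) :
    AEMeasurable (leftover A D t) P :=
  (S.aemeasurable_state t).fst

omit [IsProbabilityMeasure P] in
lemma aemeasurable_arriving (S : IsBoundedSystem P D μ B A) (t : ℕ) :
    AEMeasurable (arriving A D t) P :=
  (measurable_arrival S.measurable_policy t).comp_aemeasurable
    (aemeasurable_path S.aemeasurable_demand)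

omit [MeasurableSpace Ω] in
lemma _root_.LostSales.leftover_nonneg (t : ℕ) (ω : Ω) : 0 ≤ leftover A D t ω :=
  state_fst_nonneg t

omit [IsProbabilityMeasure P] in
lemma arriving_nonneg (S : IsBoundedSystem P D μ B A) (t : ℕ) (ω : Ω) :
    0 ≤ arriving A D t ω :=
  arrival_nonneg (S.order_nonneg _) t

omit [IsProbabilityMeasure P] in
lemma arriving_le (S : IsBoundedSystem P D μ B A) (t : ℕ) (ω : Ω) :
    arriving A D t ω ≤ B :=
  arrival_le S.bound_nonneg (S.order_le _) t

omit [IsProbabilityMeasure P] in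
lemma ae_leftover_le (S : IsBoundedSystem P D μ B A) (t : ℕ) :
    ∀ᵐ ω ∂P, leftover A D t ω ≤ t * B := by
  filter_upwards [S.ae_demand_nonneg] with ω hω
  exact state_fst_le S.bound_nonneg (S.order_le _) hω t

/-- For fixed t and u the pair almost surely lies in the compact set [0, tB] × [0, B]. If f uses
only one coordinate, the other index is a dummy. -/
lemma integrable_comp (S : IsBoundedSystem P D μ B A) {f : ℝ × ℝ → ℝ} (hf : Continuous f)
    (t u : ℕ) : Integrable (fun ω => f (leftover A D t ω, arriving A D u ω)) P := by
  obtain ⟨C, hC⟩ := ((isCompact_Icc (a := (0 : ℝ)) (b := t * B)).prod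
    (isCompact_Icc (a := (0 : ℝ)) (b := B))).exists_bound_of_continuousOn hf.continuousOn
  refine Integrable.of_bound (C := C) ?_ ?_
  · exact (hf.measurable.comp_aemeasurable
      ((S.aemeasurable_leftover t).prodMk (S.aemeasurable_arriving u))).aestronglyMeasurable
  · filter_upwards [S.ae_leftover_le t] with ω hω
    exact hC _ ⟨⟨leftover_nonneg t ω, hω⟩, S.arriving_nonneg u ω, S.arriving_le u ω⟩

lemma integrable_leftover_pow (S : IsBoundedSystem P D μ B A) (t k : ℕ) :
    Integrable (fun ω => leftover A D t ω ^ k) P :=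
  S.integrable_comp (f := fun z => z.1 ^ k) (by fun_prop) t 0

/-- Given the state, I_t is fixed and D_t is a fresh exponential variable, so
`integral_pow_leftover` applies with x = I_t. -/
lemma integral_leftover_pow (S : IsBoundedSystem P D μ B A) (t : ℕ) {k : ℕ} (hk : k ≠ 0) :
    ∫ ω, leftover A D (t + 1) ω ^ (k + 1) ∂P
        + (k + 1) * μ * ∫ ω, leftover A D (t + 1) ω ^ k ∂P
      = ∫ ω, (leftover A D t ω + arriving A D t ω) ^ (k + 1) ∂P := by
  rw [← integral_const_mul, ← integral_add (S.integrable_leftover_pow _ _)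
    ((S.integrable_leftover_pow _ _).const_mul _)]
  set f : State τ → ℝ := fun x => invLevel x (A t x) with hf
  have hfm : Measurable f :=
    measurable_invLevel.comp (measurable_id.prodMk (S.measurable_policy t))
  have hfs : ∀ ω, f (state A (fun s => D s ω) t) = leftover A D t ω + arriving A D t ω :=
    fun ω => inventory_eq t
  set G : State τ × ℝ → ℝ := fun z =>
    max 0 (f z.1 - z.2) ^ (k + 1) + (k + 1) * μ * max 0 (f z.1 - z.2) ^ k with hG
  have hGm : Measurable G := by
    have : Measurable fun z : State τ × ℝ => max 0 (f z.1 - z.2) :=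
      measurable_const.max ((hfm.comp measurable_fst).sub measurable_snd)
    exact (this.pow_const _).add ((this.pow_const _).const_mul _)
  have hGs : ∀ ω, G (state A (fun s => D s ω) t, D t ω)
      = leftover A D (t + 1) ω ^ (k + 1) + (k + 1) * μ * leftover A D (t + 1) ω ^ k :=
    fun ω => rfl
  have hind : IndepFun (fun ω => state A (fun s => D s ω) t) (D t) P :=
    (indepFun_state S.indep S.aemeasurable_demand S.measurable_policy t 1).comp
      measurable_id (measurable_pi_apply 0)
  have key := integral_comp_prodMk_of_indepFun hind (S.aemeasurable_state t)
    (S.aemeasurable_demand t) hGm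
    (by
      simp only [hGs]
      exact (S.integrable_leftover_pow _ _).add ((S.integrable_leftover_pow _ _).const_mul _))
  simp only [hGs] at key
  rw [key, (S.law t).map_eq]
  refine integral_congr_ae (Eventually.of_forall fun ω => ?_)
  simp only [hG, hfs]
  exact integral_pow_leftover S.mean_pos
    (add_nonneg (leftover_nonneg t ω) (S.arriving_nonneg t ω)) hk

/-- Replacing the leftover inventory by its projection in an expectation against the order. -/
lemma integral_order_mul_leftover (S : IsBoundedSystem P D μ B A) (r c : ℝ) (t : ℕ) :
    ∫ ω, (order A (fun s => D s ω) t - r) * (leftover A D (t + τ) ω + c) ∂P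
      = ∫ ω, (order A (fun s => D s ω) t - r) *
          (projectedInventory (expMeasure (1 / μ)) (state A (fun s => D s ω) t) + c) ∂P := by
  have : IsProbabilityMeasure (expMeasure (1 / μ)) :=
    isProbabilityMeasure_expMeasure (by have := S.mean_pos; positivity)
  set G : State τ × (Fin τ → ℝ) → ℝ := fun z =>
    (A t z.1 - r) * (finalInventory τ z.1.1 z.1.2 z.2 + c) with hG
  have hGm : Measurable G :=
    (((S.measurable_policy t).comp measurable_fst).sub_const r).mul
      ((continuous_finalInventory τ).measurable.add_const c)
  -- `leftover` at t + τ is J_{t+τ-1}, reached from the state in period t through the τ demands of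
  -- periods t, …, t+τ-1.
  have hGs : ∀ ω, G (state A (fun s => D s ω) t, fun i => D (t + i) ω)
      = (order A (fun s => D s ω) t - r) * (leftover A D (t + τ) ω + c) := fun ω => by
    simp only [hG]
    rw [leftover, ← finalInventory_state', order]
  have key := integral_comp_prodMk_of_indepFun
    (indepFun_state S.indep S.aemeasurable_demand S.measurable_policy t τ)
    (S.aemeasurable_state t)
    (aemeasurable_pi_lambda _ fun i => S.aemeasurable_demand _) hGm
    (by
      simp only [hGs]
      simpa only [arriving, arrival_add] using S.integrable_comp
        (f := fun z => (z.2 - r) * (z.1 + c)) (by fun_prop) (t + τ) (t + τ))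
  simp only [hGs] at key
  rw [key, map_demands S.indep S.law]
  refine integral_congr_ae (Eventually.of_forall fun ω => ?_)
  simp only [hG]
  rw [integral_const_mul, integral_add _ (integrable_const _)]
  · simp [projectedInventory, order, -one_div]
  · exact integrable_finalInventory (ae_nonneg_expMeasure _) (state_fst_nonneg t)
      fun i => by rw [state_snd]; exact arrival_nonneg (S.order_nonneg _) _

lemma integrable_cost (S : IsBoundedSystem P D μ B A) (h p : ℝ) (t : ℕ) :
    Integrable (fun ω => cost h p A (fun s => D s ω) t) P := by
  have h1 := S.integrable_comp (f := Prod.fst) continuous_fst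
  have h2 := S.integrable_comp (f := Prod.snd) continuous_snd t t
  have h3 := S.integrable_demand t
  simp only [cost_eq]
  exact ((h1 (t + 1) 0).const_mul h).add
    ((((h3.sub h2).add (h1 (t + 1) 0)).sub (h1 t 0)).const_mul p)

lemma integral_cost (S : IsBoundedSystem P D μ B A) (h p : ℝ) (t : ℕ) :
    ∫ ω, cost h p A (fun s => D s ω) t ∂P = h * ∫ ω, leftover A D (t + 1) ω ∂P
      + p * (μ - ∫ ω, arriving A D t ω ∂P + ∫ ω, leftover A D (t + 1) ω ∂P
        - ∫ ω, leftover A D t ω ∂P) := by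
  have h1 : ∀ t, Integrable (leftover A D t) P := fun t =>
    S.integrable_comp (f := Prod.fst) continuous_fst t 0
  have h2 : Integrable (arriving A D t) P :=
    S.integrable_comp (f := Prod.snd) continuous_snd t t
  have h3 := S.integrable_demand t
  have h4 : ∀ ω, cost h p A (fun s => D s ω) t = h * leftover A D (t + 1) ω +
      p * (D t ω - arriving A D t ω + leftover A D (t + 1) ω - leftover A D t ω) :=
    fun ω => cost_eq h p t
  simp only [h4]
  rw [integral_add ((h1 _).const_mul h) ((((h3.fun_sub h2).fun_add (h1 _)).fun_sub (h1 t)).const_mul p),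
    integral_const_mul, integral_const_mul, integral_sub ((h3.fun_sub h2).fun_add (h1 _)) (h1 t),
    integral_add (h3.fun_sub h2) (h1 _), integral_sub h3 h2, S.integral_demand]

/-- The expected cost of a period against the quadratic relative value function of the constant
order policy `C^r`. -/
lemma integral_cost_add (S : IsBoundedSystem P D μ B A) {h p r : ℝ} (hh : 0 < h) (hr : r < μ)
    (t : ℕ) :
    ∫ ω, cost h p A (fun s => D s ω) (t + τ) ∂P
      + h / (2 * (μ - r)) *
        (∫ ω, leftover A D (t + τ + 1) ω ^ 2 ∂P - ∫ ω, leftover A D (t + τ) ω ^ 2 ∂P)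
      + (2 * (h / (2 * (μ - r))) * r - p) *
        (∫ ω, leftover A D (t + τ + 1) ω ∂P - ∫ ω, leftover A D (t + τ) ω ∂P)
      = h / (2 * (μ - r)) * r ^ 2 + p * (μ - r)
        + h / (2 * (μ - r)) * ∫ ω, (order A (fun s => D s ω) t - r) ^ 2 ∂P
        + 2 * (h / (2 * (μ - r))) * ∫ ω, (order A (fun s => D s ω) t - r) *
            (leftover A D (t + τ) ω + (r - p * (μ - r) / h)) ∂P := by
  have hord : ∀ ω, order A (fun s => D s ω) t = arriving A D (t + τ) ω := fun ω =>
    (arrival_add t).symm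
  simp only [hord]
  rw [S.integral_cost]
  have hmom := S.integral_leftover_pow (t + τ) one_ne_zero
  simp only [pow_one, Nat.cast_one] at hmom
  have i1 : Integrable (leftover A D (t + τ)) P :=
    S.integrable_comp (f := Prod.fst) continuous_fst _ 0
  have i2 : Integrable (arriving A D (t + τ)) P :=
    S.integrable_comp (f := Prod.snd) continuous_snd 0 _
  have i3 := S.integrable_leftover_pow (t + τ) 2
  have i4 : Integrable (fun ω => arriving A D (t + τ) ω ^ 2) P :=
    S.integrable_comp (f := fun z => z.2 ^ 2) (by fun_prop) 0 _
  have i5 : Integrable (fun ω => leftover A D (t + τ) ω * arriving A D (t + τ) ω) P :=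
    S.integrable_comp (f := fun z => z.1 * z.2) (by fun_prop) _ _
  have e1 : ∫ ω, (leftover A D (t + τ) ω + arriving A D (t + τ) ω) ^ (1 + 1) ∂P
      = ∫ ω, leftover A D (t + τ) ω ^ 2 ∂P
        + 2 * ∫ ω, leftover A D (t + τ) ω * arriving A D (t + τ) ω ∂P
        + ∫ ω, arriving A D (t + τ) ω ^ 2 ∂P := by
    rw [← integral_const_mul, ← integral_add i3 (i5.const_mul 2),
      ← integral_add (i3.fun_add (i5.const_mul 2)) i4]
    congr 1
    funext ω
    ring
  have e2 : ∫ ω, (arriving A D (t + τ) ω - r) ^ 2 ∂P = ∫ ω, arriving A D (t + τ) ω ^ 2 ∂P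
      - 2 * r * ∫ ω, arriving A D (t + τ) ω ∂P + r ^ 2 := by
    have : ∀ ω, (arriving A D (t + τ) ω - r) ^ 2
        = arriving A D (t + τ) ω ^ 2 - 2 * r * arriving A D (t + τ) ω + r ^ 2 := fun ω => by ring
    simp only [this]
    rw [integral_add (i4.fun_sub (i2.const_mul _)) (integrable_const _),
      integral_sub i4 (i2.const_mul _), integral_const_mul]
    simp
  have e3 : ∀ c, ∫ ω, (arriving A D (t + τ) ω - r) * (leftover A D (t + τ) ω + c) ∂P
      = ∫ ω, leftover A D (t + τ) ω * arriving A D (t + τ) ω ∂P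
        + c * ∫ ω, arriving A D (t + τ) ω ∂P - r * ∫ ω, leftover A D (t + τ) ω ∂P - r * c := by
    intro c
    have : ∀ ω, (arriving A D (t + τ) ω - r) * (leftover A D (t + τ) ω + c)
        = leftover A D (t + τ) ω * arriving A D (t + τ) ω + c * arriving A D (t + τ) ω
          - r * leftover A D (t + τ) ω - r * c := fun ω => by ring
    simp only [this]
    rw [integral_sub ((i5.fun_add (i2.const_mul _)).fun_sub (i1.const_mul _)) (integrable_const _),
      integral_sub (i5.fun_add (i2.const_mul _)) (i1.const_mul _),
      integral_add i5 (i2.const_mul _), integral_const_mul, integral_const_mul]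
    simp
  rw [e1] at hmom
  rw [e2, e3]
  have hd : μ - r ≠ 0 := by linarith
  generalize (∫ ω, leftover A D (t + τ + 1) ω ∂P) = X1 at *
  generalize (∫ ω, leftover A D (t + τ) ω ∂P) = X0 at *
  generalize (∫ ω, arriving A D (t + τ) ω ∂P) = Q1 at *
  generalize (∫ ω, arriving A D (t + τ) ω ^ 2 ∂P) = Q2 at *
  generalize (∫ ω, leftover A D (t + τ) ω * arriving A D (t + τ) ω ∂P) = XQ at *
  -- After this substitution X1 has coefficient h + p - 2μa + (2ar - p) = h - 2a(μ - r) = 0, with a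
  -- = h / (2(μ - r)). Matching Q1 gives the shift r - p/(2a) = r - p(μ - r)/h.
  have hm : ∫ ω, leftover A D (t + τ + 1) ω ^ 2 ∂P
      = ∫ ω, leftover A D (t + τ) ω ^ 2 ∂P + 2 * XQ + Q2 - 2 * μ * X1 := by
    linarith
  rw [hm]
  field_simp
  ring

end IsBoundedSystem

/-! ### Long-run averages and growth of the inventory moments. -/

namespace IsBoundedSystem

variable {Ω : Type*} [MeasurableSpace Ω] {P : Measure Ω} [IsProbabilityMeasure P]
  {D : ℕ → Ω → ℝ} {μ B : ℝ} {τ : ℕ} {A : Policy τ}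

lemma costRate_eq (S : IsBoundedSystem P D μ B A) {h p : ℝ} (hh : 0 ≤ h) (hp : 0 ≤ p) :
    costRate P D h p A = limsup (fun n : ℕ => ENNReal.ofReal
      ((∑ t ∈ Finset.range (n + 1), ∫ ω, cost h p A (fun s => D s ω) (t + τ) ∂P)
        / ((n : ℝ) + 1))) atTop := by
  rw [costRate, ← limsup_nat_add _ τ]
  congr 1
  funext n
  have hsum : ∀ ω, ∑ t ∈ Finset.Icc τ (n + τ), cost h p A (fun s => D s ω) t
      = ∑ t ∈ Finset.range (n + 1), cost h p A (fun s => D s ω) (t + τ) := fun ω => by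
    rw [Finset.range_eq_Ico, Finset.sum_Ico_add' (fun t => cost h p A (fun s => D s ω) t)]
    congr 1
    ext
    simp
    omega
  simp only [hsum]
  rw [← ofReal_integral_eq_lintegral_ofReal, integral_div, integral_finsetSum]
  · push_cast
    congr 2
    ring
  · exact fun t _ => S.integrable_cost h p _
  · exact (integrable_finsetSum _ fun t _ => S.integrable_cost h p _).div_const _
  · refine Eventually.of_forall fun ω => ?_
    refine div_nonneg (Finset.sum_nonneg fun t _ => cost_nonneg hh hp _) ?_
    push_cast
    have := n.cast_nonneg (α := ℝ)
    linarith

lemma integrable_sq_sub (S : IsBoundedSystem P D μ B A) (r : ℝ) (t : ℕ) :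
    Integrable (fun ω => (r - order A (fun s => D s ω) t) ^ 2) P := by
  simpa only [arriving, arrival_add] using S.integrable_comp
    (f := fun z => (r - z.2) ^ 2) (by fun_prop) (t + τ) (t + τ)

lemma orderDivergence_eq (S : IsBoundedSystem P D μ B A) (r : ℝ) :
    orderDivergence P D A (constantOrder r) = liminf (fun n : ℕ => ENNReal.ofReal
      ((∑ t ∈ Finset.range (n + 1), ∫ ω, (r - order A (fun s => D s ω) t) ^ 2 ∂P)
        / ((n : ℝ) + 1))) atTop := by
  rw [orderDivergence, ← liminf_nat_add _ τ]
  congr 1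
  funext n
  have hpos : (0 : ℝ) < n + 1 := by positivity
  have h1 : ((n + τ : ℕ) : ℝ) - τ + 1 = n + 1 := by push_cast; ring
  rw [h1, ENNReal.ofReal_div_of_pos hpos,
    ENNReal.ofReal_sum_of_nonneg fun t _ => integral_nonneg fun ω => sq_nonneg _,
    show n + τ + 1 - τ = n + 1 by omega]
  congr 1
  refine Finset.sum_congr rfl fun t _ => ?_
  rw [ofReal_integral_eq_lintegral_ofReal (S.integrable_sq_sub r t)
    (Eventually.of_forall fun ω => sq_nonneg _)]
  rfl

-- No order arrives before period τ, so the telescoping sums start from zero.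
omit [IsProbabilityMeasure P] in
lemma leftover_leadTime_ae_eq_zero (S : IsBoundedSystem P D μ B A) :
    leftover A D τ =ᵐ[P] 0 := by
  filter_upwards [S.ae_demand_nonneg] with ω hω
  exact state_fst_of_lt hω le_rfl

/-- If the expected period costs balance and the second moment of the inventory grows
sublinearly, then cost rate and order divergence add up to the cost rate of the constant order
policy. -/
lemma costRate_add_orderDivergence (S : IsBoundedSystem P D μ B A) {h p r : ℝ} (hh : 0 < h)
    (hp : 0 < p) (hr : r < μ)
    (hbal : ∀ t, ∫ ω, (order A (fun s => D s ω) t - r) *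
        (leftover A D (t + τ) ω + (r - p * (μ - r) / h)) ∂P
      = - ∫ ω, (order A (fun s => D s ω) t - r) ^ 2 ∂P)
    (hsmall : Tendsto (fun n : ℕ => (∫ ω, leftover A D (n + 1 + τ) ω ^ 2 ∂P) / ((n : ℝ) + 1))
      atTop (nhds 0)) :
    costRate P D h p A
        + ENNReal.ofReal (h / (2 * (μ - r))) * orderDivergence P D A (constantOrder r)
      = ENNReal.ofReal (h / (2 * (μ - r)) * r ^ 2 + p * (μ - r)) := by
  rw [S.costRate_eq hh.le hp.le, S.orderDivergence_eq r,
    ← ENNReal.liminf_const_mul_of_ne_top ENNReal.ofReal_ne_top]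
  apply limsup_add_liminf_eq
  set a := h / (2 * (μ - r)) with ha
  have ha0 : 0 ≤ a := div_nonneg hh.le (by linarith)
  set g := a * r ^ 2 + p * (μ - r) with hg
  set b := 2 * a * r - p with hb
  set x1 : ℕ → ℝ := fun t => ∫ ω, leftover A D (t + τ) ω ∂P with hx1
  set x2 : ℕ → ℝ := fun t => ∫ ω, leftover A D (t + τ) ω ^ 2 ∂P with hx2
  set V : ℕ → ℝ := fun t => ∫ ω, (r - order A (fun s => D s ω) t) ^ 2 ∂P with hV
  set c : ℕ → ℝ := fun t => ∫ ω, cost h p A (fun s => D s ω) (t + τ) ∂P with hc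
  have hx10 : x1 0 = 0 := by
    simp only [hx1, zero_add]
    rw [integral_congr_ae S.leftover_leadTime_ae_eq_zero]
    simp
  have hx20 : x2 0 = 0 := by
    simp only [hx2, zero_add]
    rw [integral_eq_zero_of_ae]
    filter_upwards [S.leftover_leadTime_ae_eq_zero] with ω hω
    simp [hω]
  have hV' : ∀ t, ∫ ω, (order A (fun s => D s ω) t - r) ^ 2 ∂P = V t := fun t => by
    simp only [hV]
    congr 1
    funext ω
    ring
  -- By `hbal` the cross term is -2a V t, which turns +a V t into -a V t.
  have hstep : ∀ t, c t + a * V t = g - a * (x2 (t + 1) - x2 t) - b * (x1 (t + 1) - x1 t) := by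
    intro t
    have h1 := S.integral_cost_add (p := p) hh hr t
    rw [hbal t, hV' t] at h1
    simp only [hx1, hx2, hc, hb, hg, ha, show t + 1 + τ = t + τ + 1 by ring]
    linarith
  have hsum : ∀ n, ∑ t ∈ Finset.range n, c t + a * ∑ t ∈ Finset.range n, V t
      = n * g - a * x2 n - b * x1 n := by
    intro n
    rw [Finset.mul_sum, ← Finset.sum_add_distrib, Finset.sum_congr rfl fun t _ => hstep t,
      Finset.sum_sub_distrib, Finset.sum_sub_distrib, ← Finset.mul_sum, ← Finset.mul_sum,
      Finset.sum_range_sub, Finset.sum_range_sub, hx10, hx20]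
    simp
  -- From x ≤ 1 + x²: the first moment inherits sublinear growth.
  have hx1le : ∀ n, |x1 n| ≤ 1 + x2 n := by
    intro n
    have i1 : Integrable (leftover A D (n + τ)) P :=
      S.integrable_comp (f := Prod.fst) continuous_fst _ 0
    rw [abs_of_nonneg (integral_nonneg fun ω => leftover_nonneg _ ω)]
    have h2 := integral_mono i1 ((integrable_const (1 : ℝ)).add
      (S.integrable_leftover_pow (n + τ) 2)) fun ω => by
        simp only [Pi.add_apply]
        nlinarith [sq_nonneg (leftover A D (n + τ) ω - 1),
          leftover_nonneg (A := A) (D := D) (n + τ) ω]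
    simp only [Pi.add_apply] at h2
    rw [integral_add (integrable_const _) (S.integrable_leftover_pow _ _)] at h2
    simpa using h2
  have hone : Tendsto (fun n : ℕ => 1 / ((n : ℝ) + 1)) atTop (nhds 0) :=
    tendsto_one_div_add_atTop_nhds_zero_nat
  have hsmall1 : Tendsto (fun n : ℕ => x1 (n + 1) / ((n : ℝ) + 1)) atTop (nhds 0) := by
    refine squeeze_zero_norm (fun n => ?_) (by simpa using hone.add hsmall)
    have hpos : (0 : ℝ) < n + 1 := by positivity
    rw [Real.norm_eq_abs, abs_div, abs_of_pos hpos, inv_eq_one_div, ← add_div]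
    exact div_le_div_of_nonneg_right (hx1le _) hpos.le
  have hlim : Tendsto (fun n : ℕ => g - a * (x2 (n + 1) / ((n : ℝ) + 1))
      - b * (x1 (n + 1) / ((n : ℝ) + 1))) atTop (nhds g) := by
    simpa using ((hsmall.const_mul a).const_sub g).sub (hsmall1.const_mul b)
  refine (ENNReal.tendsto_ofReal hlim).congr fun n => ?_
  have hpos : (0 : ℝ) < n + 1 := by positivity
  have hc0 : 0 ≤ ∑ t ∈ Finset.range (n + 1), c t := Finset.sum_nonneg fun t _ =>
    integral_nonneg fun ω => cost_nonneg hh.le hp.le _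
  have hV0 : 0 ≤ ∑ t ∈ Finset.range (n + 1), V t := Finset.sum_nonneg fun t _ =>
    integral_nonneg fun ω => sq_nonneg _
  rw [← ENNReal.ofReal_mul ha0, ← ENNReal.ofReal_add (by positivity) (by positivity)]
  congr 1
  have := hsum (n + 1)
  push_cast at this
  field_simp
  linarith

/-- The moment recursions for k = 2 and k = 1 give E[J'³] = E[I³] - 3μ E[I²] + 6μ² E[J'], with E[J']
≤ E[I]. As I ≤ J + B with B < μ, the quadratic part has negative drift, and the increment is bounded
by a constant. -/
lemma integral_leftover_cube_succ_le (S : IsBoundedSystem P D μ B A) (hB : B < μ) (t : ℕ) :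
    ∫ ω, leftover A D (t + 1) ω ^ 3 ∂P ≤ ∫ ω, leftover A D t ω ^ 3 ∂P
      + ((3 * B ^ 2 + 6 * μ ^ 2) ^ 2 / (12 * (μ - B)) + B ^ 3 + 6 * μ ^ 2 * B) := by
  have hμ := S.mean_pos
  have hB0 := S.bound_nonneg
  have h3 := S.integral_leftover_pow t (k := 2) two_ne_zero
  have h2 := S.integral_leftover_pow t (k := 1) one_ne_zero
  have hx : ∀ t, Integrable (leftover A D t) P := fun t =>
    S.integrable_comp (f := Prod.fst) continuous_fst t 0
  have ha : Integrable (arriving A D t) P :=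
    S.integrable_comp (f := Prod.snd) continuous_snd 0 t
  have hI : ∀ k, Integrable (fun ω => (leftover A D t ω + arriving A D t ω) ^ k) P := fun k =>
    S.integrable_comp (f := fun z => (z.1 + z.2) ^ k) (by fun_prop) t t
  have h1 : ∫ ω, leftover A D (t + 1) ω ∂P
      ≤ ∫ ω, (leftover A D t ω + arriving A D t ω) ∂P := by
    refine integral_mono_ae (hx _) ((hx t).add ha) ?_
    filter_upwards [S.ae_demand_nonneg] with ω hω
    rw [leftover, state_succ_fst]
    have := leftover_nonneg (A := A) (D := D) t ω
    have := S.arriving_nonneg t ω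
    simp only [leftover, arriving] at *
    exact max_le (by linarith) (by linarith [hω t])
  simp only [pow_one, Nat.cast_one, Nat.cast_ofNat, Nat.reduceAdd] at h2 h3
  norm_num at h2 h3
  have hI1 : Integrable (fun ω => leftover A D t ω + arriving A D t ω) P := (hx t).add ha
  set K := (3 * B ^ 2 + 6 * μ ^ 2) ^ 2 / (12 * (μ - B)) + B ^ 3 + 6 * μ ^ 2 * B with hK
  have key : ∫ ω, ((leftover A D t ω + arriving A D t ω) ^ 3
        - 3 * μ * (leftover A D t ω + arriving A D t ω) ^ 2
        + 6 * μ ^ 2 * (leftover A D t ω + arriving A D t ω)) ∂P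
      ≤ ∫ ω, (leftover A D t ω ^ 3 + K) ∂P := by
    refine integral_mono ((((hI 3).sub ((hI 2).const_mul _))).add (hI1.const_mul _))
      ((S.integrable_leftover_pow t 3).add (integrable_const _)) fun ω => ?_
    have y0 := leftover_nonneg (A := A) (D := D) t ω
    have c0 := S.arriving_nonneg t ω
    have c1 := S.arriving_le t ω
    simp only
    generalize leftover A D t ω = y at *
    generalize arriving A D t ω = c at *
    have hδ : 0 < μ - B := by linarith
    have e1 : (y + c) ^ 3 - 3 * μ * (y + c) ^ 2 + 6 * μ ^ 2 * (y + c)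
        ≤ y ^ 3 - 3 * (μ - B) * y ^ 2 + (3 * B ^ 2 + 6 * μ ^ 2) * y + B ^ 3
          + 6 * μ ^ 2 * B := by
      have q1 : c ^ 2 ≤ B ^ 2 := pow_le_pow_left₀ c0 c1 2
      have q2 : c ^ 3 ≤ B ^ 3 := pow_le_pow_left₀ c0 c1 3
      have q3 : c * y ^ 2 ≤ B * y ^ 2 := mul_le_mul_of_nonneg_right c1 (sq_nonneg y)
      have q4 : c ^ 2 * y ≤ B ^ 2 * y := mul_le_mul_of_nonneg_right q1 y0
      have q5 : μ ^ 2 * c ≤ μ ^ 2 * B := mul_le_mul_of_nonneg_left c1 (sq_nonneg μ)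
      have q6 : 0 ≤ μ * (c * y) := by positivity
      have q7 : 0 ≤ μ * c ^ 2 := by positivity
      nlinarith
    -- The maximum of βy - αy² is β² / (4α), here with α = 3(μ - B).
    have e2 : - 3 * (μ - B) * y ^ 2 + (3 * B ^ 2 + 6 * μ ^ 2) * y
        ≤ (3 * B ^ 2 + 6 * μ ^ 2) ^ 2 / (12 * (μ - B)) := by
      rw [le_div_iff₀ (by positivity)]
      nlinarith [sq_nonneg (6 * (μ - B) * y - (3 * B ^ 2 + 6 * μ ^ 2))]
    linarith
  rw [integral_add ((hI 3).fun_sub ((hI 2).const_mul _)) (hI1.const_mul _),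
    integral_sub (hI 3) ((hI 2).const_mul _), integral_const_mul, integral_const_mul,
    integral_add (S.integrable_leftover_pow t 3) (integrable_const _)] at key
  simp only [integral_const, probReal_univ, one_smul] at key
  nlinarith [mul_le_mul_of_nonneg_left h1 (sq_nonneg μ)]

/-- If all orders are below the mean demand, the second moment of the inventory grows
sublinearly. -/
lemma tendsto_leftover_sq_div (S : IsBoundedSystem P D μ B A) (hB : B < μ) :
    Tendsto (fun n : ℕ => (∫ ω, leftover A D (n + 1 + τ) ω ^ 2 ∂P) / ((n : ℝ) + 1))
      atTop (nhds 0) := by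
  set K := (3 * B ^ 2 + 6 * μ ^ 2) ^ 2 / (12 * (μ - B)) + B ^ 3 + 6 * μ ^ 2 * B with hK
  have hcube : ∀ n : ℕ, ∫ ω, leftover A D (n + τ) ω ^ 3 ∂P ≤ n * K := by
    intro n
    induction n with
    | zero =>
      rw [integral_eq_zero_of_ae]
      · simp
      · filter_upwards [S.leftover_leadTime_ae_eq_zero] with ω hω
        simp [hω]
    | succ n ih =>
      have := S.integral_leftover_cube_succ_le hB (n + τ)
      rw [show n + 1 + τ = n + τ + 1 by ring]
      push_cast
      linarith
  -- Truncation at level M: y² ≤ y³ / M + M² for y ≥ 0.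
  have hsq : ∀ (n : ℕ) {M : ℝ}, 0 < M →
      ∫ ω, leftover A D (n + τ) ω ^ 2 ∂P ≤ n * K / M + M ^ 2 := by
    intro n M hM
    have h1 := integral_mono (S.integrable_leftover_pow (n + τ) 2)
      (((S.integrable_leftover_pow (n + τ) 3).div_const M).add (integrable_const (M ^ 2)))
      fun ω => by
        have y0 := leftover_nonneg (A := A) (D := D) (n + τ) ω
        simp only [Pi.add_apply]
        generalize leftover A D (n + τ) ω = y at *
        rcases le_total y M with hy | hy
        · have := pow_le_pow_left₀ y0 hy 2
          have : 0 ≤ y ^ 3 / M := by positivity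
          linarith
        · have : y ^ 2 ≤ y ^ 3 / M := by
            rw [le_div_iff₀ hM]
            nlinarith [mul_le_mul_of_nonneg_left hy (sq_nonneg y)]
          nlinarith [sq_nonneg M]
    simp only [Pi.add_apply] at h1
    rw [integral_add ((S.integrable_leftover_pow (n + τ) 3).div_const M) (integrable_const _),
      integral_div] at h1
    have h2 := div_le_div_of_nonneg_right (hcube n) hM.le
    simp only [integral_const, probReal_univ, one_smul] at h1
    linarith
  have hN : Tendsto (fun n : ℕ => (n : ℝ) + 1) atTop atTop :=
    tendsto_atTop_add_const_right _ _ tendsto_natCast_atTop_atTop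
  have hs : Tendsto (fun n : ℕ => √((n : ℝ) + 1)) atTop atTop :=
    Real.tendsto_sqrt_atTop.comp hN
  have hss : Tendsto (fun n : ℕ => √√((n : ℝ) + 1)) atTop atTop :=
    Real.tendsto_sqrt_atTop.comp hs
  have hlim : Tendsto (fun n : ℕ => K * (√√((n : ℝ) + 1))⁻¹ + (√((n : ℝ) + 1))⁻¹) atTop
      (nhds 0) := by
    simpa using ((tendsto_inv_atTop_zero.comp hss).const_mul K).add
      (tendsto_inv_atTop_zero.comp hs)
  refine squeeze_zero (fun n => ?_) (fun n => ?_) hlim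
  · exact div_nonneg (integral_nonneg fun ω => sq_nonneg _) (by positivity)
  · have hpos : (0 : ℝ) < n + 1 := by positivity
    have hp1 : 0 < √((n : ℝ) + 1) := Real.sqrt_pos.2 hpos
    have hp2 : 0 < √√((n : ℝ) + 1) := Real.sqrt_pos.2 hp1
    -- The choice M = (n + 1)^(1/4) makes both nK/M and M² sublinear in n.
    have h1 := hsq (n + 1) hp2
    rw [Real.sq_sqrt hp1.le] at h1
    rw [Nat.cast_add_one] at h1
    rw [div_le_iff₀ hpos]
    refine h1.trans_eq ?_
    have h2 : (√((n : ℝ) + 1))⁻¹ * ((n : ℝ) + 1) = √((n : ℝ) + 1) := by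
      rw [inv_mul_eq_iff_eq_mul₀ hp1.ne', Real.mul_self_sqrt hpos.le]
    linear_combination (-1) * h2

end IsBoundedSystem

/-! ### The constant order and projected inventory level policies. -/

section Policies

variable {Ω : Type*} [MeasurableSpace Ω] {P : Measure Ω} [IsProbabilityMeasure P]
  {D : ℕ → Ω → ℝ} {μ : ℝ} {τ : ℕ}

omit [IsProbabilityMeasure P] in
lemma isBoundedSystem_constantOrder (hμ : 0 < μ) (hindep : iIndepFun D P)
    (hlaw : ∀ t, HasLaw (D t) (expMeasure (1 / μ)) P) {r : ℝ} (hr : 0 ≤ r) :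
    IsBoundedSystem P D μ r (constantOrder (τ := τ) r) where
  mean_pos := hμ
  indep := hindep
  law := hlaw
  measurable_policy _ := measurable_const
  order_nonneg _ _ := hr
  order_le _ _ := le_rfl

omit [IsProbabilityMeasure P] in
lemma isBoundedSystem_projectedInventoryLevel (hμ : 0 < μ) (hindep : iIndepFun D P)
    (hlaw : ∀ t, HasLaw (D t) (expMeasure (1 / μ)) P) {U : ℝ} (hU : 0 ≤ U) :
    IsBoundedSystem P D μ U (projectedInventoryLevel (τ := τ) (expMeasure (1 / μ)) U) where
  mean_pos := hμ
  indep := hindep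
  law := hlaw
  measurable_policy _ := by
    have : IsProbabilityMeasure (expMeasure (1 / μ)) :=
      isProbabilityMeasure_expMeasure (by positivity)
    exact measurable_const.max (measurable_const.sub measurable_projectedInventory)
  order_nonneg _ _ := le_max_left _ _
  order_le d t := by
    have := projectedInventory_nonneg (ν := expMeasure (1 / μ)) (state_fst_nonneg
      (A := projectedInventoryLevel (τ := τ) (expMeasure (1 / μ)) U) (d := d) t)
    exact max_le hU (by linarith)

/-- The order never deviates from r, so both sides of the balance condition and the divergence
vanish; r < μ gives the sublinear growth. -/
lemma costRate_constantOrder (hμ : 0 < μ) (hindep : iIndepFun D P)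
    (hlaw : ∀ t, HasLaw (D t) (expMeasure (1 / μ)) P) {h p r : ℝ} (hh : 0 < h) (hp : 0 < p)
    (hr : r ∈ Set.Ico 0 μ) :
    costRate P D h p (constantOrder (τ := τ) r)
      = ENNReal.ofReal (h / (2 * (μ - r)) * r ^ 2 + p * (μ - r)) := by
  have S := isBoundedSystem_constantOrder (τ := τ) hμ hindep hlaw hr.1
  rw [← S.costRate_add_orderDivergence hh hp hr.2 (fun t => by simp [order, constantOrder])
    (S.tendsto_leftover_sq_div hr.2), S.orderDivergence_eq r]
  simp [order, constantOrder]

lemma costRate_projectedInventoryLevel_add (hμ : 0 < μ) (hindep : iIndepFun D P)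
    (hlaw : ∀ t, HasLaw (D t) (expMeasure (1 / μ)) P) {h p r : ℝ} (hh : 0 < h) (hp : 0 < p)
    (hr : r ∈ Set.Ico 0 μ) :
    costRate P D h p (projectedInventoryLevel (τ := τ) (expMeasure (1 / μ)) (p * (μ - r) / h))
        + ENNReal.ofReal (h / (2 * (μ - r))) * orderDivergence P D
          (projectedInventoryLevel (τ := τ) (expMeasure (1 / μ)) (p * (μ - r) / h))
          (constantOrder r)
      = ENNReal.ofReal (h / (2 * (μ - r)) * r ^ 2 + p * (μ - r)) := by
  set U := p * (μ - r) / h with hUdef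
  have hU : 0 ≤ U := by
    have := hr.2
    exact div_nonneg (mul_nonneg hp.le (by linarith)) hh.le
  set ν := expMeasure (1 / μ) with hν
  have hb : 0 < 1 / μ := by positivity
  have : IsProbabilityMeasure ν := isProbabilityMeasure_expMeasure hb
  have hνn : ∀ᵐ x ∂ν, 0 ≤ x := ae_nonneg_expMeasure _
  set A : Policy τ := projectedInventoryLevel ν U with hA
  have S : IsBoundedSystem P D μ U A :=
    isBoundedSystem_projectedInventoryLevel hμ hindep hlaw hU
  refine S.costRate_add_orderDivergence hh hp hr.2 (fun t => ?_) ?_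
  · rw [S.integral_order_mul_leftover, ← integral_neg]
    refine integral_congr_ae ?_
    filter_upwards [S.ae_demand_nonneg] with ω hω
    have h1 := projectedInventory_state_le (τ := τ) hνn hU hω t
    -- The projection stays at or below U, so the positive part is inactive and the order is affine
    -- in the projection.
    have h2 : order A (fun s => D s ω) t
        = U - projectedInventory ν (state A (fun s => D s ω) t) :=
      max_eq_right (by linarith)
    rw [h2, ← hUdef]
    ring
  · have hone : Tendsto (fun n : ℕ => 1 / ((n : ℝ) + 1)) atTop (nhds 0) :=
      tendsto_one_div_add_atTop_nhds_zero_nat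
    refine squeeze_zero (fun n => ?_) (fun n => ?_)
      (by simpa using hone.const_mul ((U + τ * μ) ^ 2))
    · exact div_nonneg (integral_nonneg fun ω => sq_nonneg _) (by positivity)
    · rw [← div_eq_mul_inv]
      refine div_le_div_of_nonneg_right ?_ (by positivity)
      -- U may exceed μ, so the drift argument is not available; instead the inventory is at most
      -- the projection plus τμ, hence at most U + τμ.
      have : ∫ ω, leftover A D (n + 1 + τ) ω ^ 2 ∂P ≤ ∫ _, (U + τ * μ) ^ 2 ∂P := by
        refine integral_mono_ae (S.integrable_leftover_pow _ _) (integrable_const _) ?_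
        filter_upwards [S.ae_demand_nonneg] with ω hω
        refine pow_le_pow_left₀ (leftover_nonneg _ _) ?_ 2
        have h1 := projectedInventory_state_le (τ := τ) hνn hU hω (n + 1 + τ)
        have h2 := le_projectedInventory hνn (integrable_id_expMeasure hb)
          (state_fst_nonneg (A := A) (d := fun s => D s ω) (n + 1 + τ))
          (fun i => by rw [state_snd]; exact arrival_nonneg (S.order_nonneg _) _)
        rw [integral_id_expMeasure hb, one_div_one_div] at h2
        rw [leftover]
        linarith
      simpa using this

end Policies

end LostSales

theorem mainTheorem3 {Ω : Type*} [MeasurableSpace Ω] (P : Measure Ω) [IsProbabilityMeasure P]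
    (D : ℕ → Ω → ℝ) (μ h p : ℝ) (hμ : 0 < μ) (hh : 0 < h) (hp : 0 < p)
    (hindep : iIndepFun D P)
    (hlaw : ∀ t, HasLaw (D t) (expMeasure (1 / μ)) P)
    (τ : ℕ) (rstar : ℝ) (hr : rstar ∈ Set.Ico 0 μ)
    (hrmin : IsMinOn
      (fun r : ℝ => LostSales.costRate P D h p (LostSales.constantOrder (τ := τ) r))
      (Set.Ico 0 μ) rstar) :
    let COP : ℝ → LostSales.Policy τ := LostSales.constantOrder
    let PIL : ℝ → LostSales.Policy τ := LostSales.projectedInventoryLevel (expMeasure (1 / μ))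
    let C : LostSales.Policy τ → ℝ≥0∞ := LostSales.costRate P D h p
    let U : ℝ := p * (μ - rstar) / h
    let a₁ : ℝ := h / (2 * (μ - rstar))
    (∀ Ustar : ℝ, 0 ≤ Ustar → IsMinOn (fun V : ℝ => C (PIL V)) (Set.Ici 0) Ustar →
      C (PIL Ustar) ≤ C (PIL U)) ∧
    C (PIL U) ≤ C (COP rstar) ∧
    C (COP rstar) < ∞ ∧
    C (COP rstar) =
      C (PIL U) + ENNReal.ofReal a₁ * LostSales.orderDivergence P D (PIL U) (COP rstar) := by
  intro COP PIL C U a₁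
  have hadd : C (PIL U)
      + ENNReal.ofReal a₁ * LostSales.orderDivergence P D (PIL U) (COP rstar)
        = ENNReal.ofReal (a₁ * rstar ^ 2 + p * (μ - rstar)) :=
    LostSales.costRate_projectedInventoryLevel_add hμ hindep hlaw hh hp hr
  have hcop : C (COP rstar) = ENNReal.ofReal (a₁ * rstar ^ 2 + p * (μ - rstar)) :=
    LostSales.costRate_constantOrder hμ hindep hlaw hh hp hr
  have hU : 0 ≤ U := div_nonneg (mul_nonneg hp.le (sub_nonneg.2 hr.2.le)) hh.le
  refine ⟨fun Ustar _ hmin => hmin hU, ?_, ?_, ?_⟩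
  · rw [hcop, ← hadd]
    exact le_self_add
  · rw [hcop]
    exact ENNReal.ofReal_lt_top
  · rw [hcop, hadd]
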